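/- Let $M$ be a model plane: a Euclidean plane, a hyperbolic plane (of any constant curvature), or a round $2$-sphere (of any radius, with its great-circle metric). Let $P \subset M$ be a polygon, i.e. a closed topological disk whose boundary $\partial P$ is a simple closed curve that is a concatenation of finitely many geodesic segments; if $M$ is a sphere, $P$ is properly contained in a hemisphere. Give $P$ its intrinsic metric $d_P$, where $d_P(x,y)$ is the infimum of the lengths of the curves in $P$ from $x$ to $y$. A *segment pairing* $\langle\alpha,\alpha'\rangle$ consists of two geodesic segments $\alpha,\alpha' \subset \partial P$ of the same length $L>0$ with disjoint interiors; parametrizing both by arc length along a fixed orientation of $\partial P$, it pairs $\alpha(t)$ with $\alpha'(L-t)$, $0\le t\le L$. A *paper-folding scheme* $(P,\mathcal P)$ is a (finite or countably infinite) collection $\mathcal P$ of segment pairings such that the interiors of all the segments occurring in it are pairwise disjoint and the lengths $L$ of its pairings add up to half the length of $\partial P$. Write $x \mathrel{\mathcal P} y$ if $x=y$ or $x,y$ are paired by an element of $\mathcal P$. The *paper space* of $(P,\mathcal P)$ is the metric quotient of $P$ by this relation: the quotient semi-metric is $$d^{\mathcal P}(x,y)=\inf \sum_{j=1}^N d_P(x_j,y_j),$$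 the infimum being over all $N\ge 1$ and all $x=x_1,y_1,x_2,y_2,\dots,x_N,y_N=y$ in $P$ with $y_j \mathrel{\mathcal P} x_{j+1}$ for $1\le j<N$, and points at semi-distance $0$ are identified. Let $C$ be an arc in $\partial P$ or $\partial P$ itself. Two pairs of points of $C$ are *unlinked* in $C$ if one of them lies in the closure of a connected component of the complement in $C$ of the other. A relation $R$ is *unlinked on $C$* if $\{x,x'\}$ and $\{y,y'\}$ are unlinked whenever $x,x',y,y'\in C$, $x\mathrel R x'$, $y\mathrel R y'$ and neither of $x,x'$ is related to $y$ or to $y'$. The scheme $(P,\mathcal P)$ is *plain* if $\mathcal P$ is unlinked on $\partial P$. An arc $\gamma\subset\partial P$ is *$\mathcal P$-plain* if every pairing $\langle\alpha,\alpha'\rangle\in\mathcal P$ such that $\alpha\cup\alpha'$ meets the interior of $\gamma$ satisfies $\alpha\cup\alpha'\subset\gamma$, and $\mathcal P$ is unlinked on $\gamma$. **Theorem.** Let $(P,\mathcal P)$ be a plain paper-folding scheme, let $\gamma_n\subset\partial P$, $n\in\mathbb N$, be $\mathcal P$-plain arcs, and let $(P,\mathcal P_n)$ be paper-folding schemes such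 that, for every $n$, $\mathcal P_n$ agrees with $\mathcal P$ off $\gamma_n$ (that is, $x\mathrel{\mathcal P_n}y$ if and only if $x\mathrel{\mathcal P}y$, for all $x,y\in\partial P\setminus\gamma_n$) and $\gamma_n$ is $\mathcal P_n$-plain. Let $S$ and $S_n$ be the paper spaces of $(P,\mathcal P)$ and $(P,\mathcal P_n)$. If the lengths $|\gamma_n|$ tend to $0$, then $d_{GH}(S,S_n)\to 0$, where $d_{GH}$ is the Gromov–Hausdorff distance (half the infimum of the distortions of the correspondences between the two spaces). -/

import Mathlib

open Set Filter Topology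
open scoped ENNReal

noncomputable section

namespace PaperFolding

/-! ### Metric quotients -/

/-- A walk from `x` to `y` for the relation `R`: steps `{p i, q i}` for `0 ≤ i ≤ N`, joined by
jumps `q i → p (i + 1)` between `R`-related points for `i < N`. (The values of `p` and `q` at
indices larger than `N` play no role.) -/
structure Walk {X : Type*} (R : X → X → Prop) (x y : X) where
  N : ℕ
  p : ℕ → X
  q : ℕ → X
  start : p 0 = x
  finish : q N = y
  jump : ∀ i < N, R (q i) (p (i + 1))

/-- The length of a walk is the sum of the lengths of its steps. -/
def Walk.length {X : Type*} {R : X → X → Prop} {x y : X} (w : Walk R x y)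
    (d : X → X → ℝ≥0∞) : ℝ≥0∞ :=
  ∑ i ∈ Finset.range (w.N + 1), d (w.p i) (w.q i)

/-- The quotient semi-metric of `(X, d)` associated to the relation `R`. -/
def quotientEDist {X : Type*} (d : X → X → ℝ≥0∞) (R : X → X → Prop) (x y : X) : ℝ≥0∞ :=
  ⨅ w : Walk R x y, w.length d

theorem quotientEDist_self {X : Type*} (d : X → X → ℝ≥0∞) (R : X → X → Prop)
    (hd : ∀ x, d x x = 0) (x : X) : quotientEDist d R x x = 0 := by
  refine le_antisymm (iInf_le_of_le
    ⟨0, fun _ => x, fun _ => x, rfl, rfl, fun i hi => absurd hi (Nat.not_lt_zero i)⟩ ?_) bot_le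
  simp [Walk.length, hd]

theorem quotientEDist_le_symm {X : Type*} (d : X → X → ℝ≥0∞) (R : X → X → Prop)
    (hd : ∀ x y, d x y = d y x) (hR : ∀ x y, R x y → R y x) (x y : X) :
    quotientEDist d R x y ≤ quotientEDist d R y x := by
  refine le_iInf fun w => iInf_le_of_le
    ⟨w.N, fun i => w.q (w.N - i), fun i => w.p (w.N - i), by simpa using w.finish,
      by simpa using w.start, fun i hi => ?_⟩ ?_
  · have h := w.jump (w.N - (i + 1)) (by omega)
    rw [show w.N - (i + 1) + 1 = w.N - i by omega] at h
    exact hR _ _ h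
  · simp only [Walk.length]
    rw [← Finset.sum_range_reflect]
    refine le_of_eq (Finset.sum_congr rfl fun i hi => ?_)
    have hi' : i < w.N + 1 := Finset.mem_range.1 hi
    rw [hd, show w.N - (w.N + 1 - 1 - i) = i by omega]

theorem quotientEDist_triangle {X : Type*} (d : X → X → ℝ≥0∞) (R : X → X → Prop)
    (hR : ∀ x, R x x) (x y z : X) :
    quotientEDist d R x z ≤ quotientEDist d R x y + quotientEDist d R y z := by
  unfold quotientEDist
  rw [ENNReal.iInf_add]
  refine le_iInf fun v => ?_
  rw [ENNReal.add_iInf]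
  refine le_iInf fun w => iInf_le_of_le
    ⟨v.N + 1 + w.N, fun i => if i < v.N + 1 then v.p i else w.p (i - (v.N + 1)),
      fun i => if i < v.N + 1 then v.q i else w.q (i - (v.N + 1)), by simpa using v.start,
      by simpa [show ¬ (v.N + 1 + w.N ≤ v.N) by omega] using w.finish, fun i hi => ?_⟩ ?_
  · by_cases h1 : i + 1 < v.N + 1
    · simpa [h1, show i < v.N + 1 by omega] using v.jump i (by omega)
    · by_cases h2 : i < v.N + 1
      · have h3 : i = v.N := by omega
        subst h3
        simpa [v.finish, w.start] using hR y
      · have h := w.jump (i - (v.N + 1)) (by omega)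
        rw [show i - (v.N + 1) + 1 = i + 1 - (v.N + 1) by omega] at h
        simpa only [h1, h2, if_false] using h
  · simp only [Walk.length]
    rw [show v.N + 1 + w.N + 1 = (v.N + 1) + (w.N + 1) by omega, Finset.sum_range_add]
    refine le_of_eq (congrArg₂ _ (Finset.sum_congr rfl fun i hi => ?_)
      (Finset.sum_congr rfl fun i _ => ?_))
    · simp [Finset.mem_range.1 hi]
    · simp [show ¬ (v.N + 1 + i ≤ v.N) by omega]

/-! ### Intrinsic metrics -/

/-- A curve in `A` from `x` to `y`. -/
structure CurveIn {M : Type*} [MetricSpace M] (A : Set M) (x y : M) where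
  toFun : ℝ → M
  continuousOn : ContinuousOn toFun (Icc 0 1)
  mapsTo : MapsTo toFun (Icc 0 1) A
  start : toFun 0 = x
  finish : toFun 1 = y

/-- The intrinsic metric of a subset `A`: the infimum of the lengths of the curves in `A`. -/
def intrinsicEDist {M : Type*} [MetricSpace M] (A : Set M) (x y : M) : ℝ≥0∞ :=
  ⨅ c : CurveIn A x y, eVariationOn c.toFun (Icc 0 1)

theorem intrinsicEDist_self {M : Type*} [MetricSpace M] (A : Set M) (x : M) (hx : x ∈ A) :
    intrinsicEDist A x x = 0 := by
  refine le_antisymm (iInf_le_of_le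
    ⟨fun _ => x, continuousOn_const, fun _ _ => hx, rfl, rfl⟩ ?_) bot_le
  exact le_of_eq (eVariationOn.constant_on (by simp [Set.Subsingleton]))

theorem intrinsicEDist_le_symm {M : Type*} [MetricSpace M] (A : Set M) (x y : M) :
    intrinsicEDist A x y ≤ intrinsicEDist A y x := by
  have hm : MapsTo (fun t : ℝ => 1 - t) (Icc 0 1) (Icc 0 1) := fun t ht =>
    ⟨by linarith [ht.2], by linarith [ht.1]⟩
  refine le_iInf fun c => iInf_le_of_le
    ⟨c.toFun ∘ fun t => 1 - t, c.continuousOn.comp (by fun_prop) hm,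
      c.mapsTo.comp hm, by simpa using c.finish, by simpa using c.start⟩ ?_
  exact eVariationOn.comp_le_of_antitoneOn _ _ (fun a _ b _ h => sub_le_sub_left h 1) hm

/-! ### Gromov–Hausdorff distance -/

/-- A correspondence between `X` and `Y`. -/
def IsCorrespondence {X Y : Type*} (R : Set (X × Y)) : Prop :=
  (∀ x, ∃ y, (x, y) ∈ R) ∧ ∀ y, ∃ x, (x, y) ∈ R

/-- The distortion `sup |d(x, x') - d(y, y')|` over all `(x, y), (x', y') ∈ R`. Subtraction of
extended non-negative reals is truncated, so the maximum of the two differences is the absolute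
value of the difference. -/
def distortion {X Y : Type*} [EMetricSpace X] [EMetricSpace Y] (R : Set (X × Y)) : ℝ≥0∞ :=
  ⨆ u ∈ R, ⨆ v ∈ R, max (edist u.1 v.1 - edist u.2 v.2) (edist u.2 v.2 - edist u.1 v.1)

/-- The Gromov–Hausdorff distance: half the infimum of the distortions of correspondences. -/
def gromovHausdorffEDist (X Y : Type*) [EMetricSpace X] [EMetricSpace Y] : ℝ≥0∞ :=
  (⨅ R : {R : Set (X × Y) // IsCorrespondence R}, distortion R.1) / 2

/-! ### Model planes, geodesics and polygons -/

/-- `M` is isometric to the Euclidean plane. -/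
def IsEuclideanPlane (M : Type*) [MetricSpace M] : Prop :=
  Nonempty (M ≃ᵢ EuclideanSpace ℝ (Fin 2))

/-- `M` is isometric to a hyperbolic plane of constant curvature `-1 / r ^ 2`. -/
def IsHyperbolicPlane (M : Type*) [MetricSpace M] : Prop :=
  ∃ r : ℝ, 0 < r ∧ ∃ e : M ≃ UpperHalfPlane, ∀ x y, dist x y = r * dist (e x) (e y)

/-- `M` is isometric to the round sphere of radius `r` with its angular (great-circle) metric. -/
def IsRoundSphere (M : Type*) [MetricSpace M] (r : ℝ) : Prop :=
  0 < r ∧ ∃ e : M ≃ Metric.sphere (0 : EuclideanSpace ℝ (Fin 3)) 1, ∀ x y, dist x y =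
    r * InnerProductGeometry.angle (e x : EuclideanSpace ℝ (Fin 3))
      (e y : EuclideanSpace ℝ (Fin 3))

/-- A model plane: a Euclidean plane, a hyperbolic plane or a round sphere. -/
def IsModelPlane (M : Type*) [MetricSpace M] : Prop :=
  IsEuclideanPlane M ∨ IsHyperbolicPlane M ∨ ∃ r, IsRoundSphere M r

/-- `β` is a geodesic parametrized by arc length on `I`, i.e. it is locally isometric. -/
def IsGeodesicOn {M : Type*} [MetricSpace M] (β : ℝ → M) (I : Set ℝ) : Prop :=
  ∀ t ∈ I, ∃ ε > 0, ∀ u ∈ I, ∀ v ∈ I, |u - t| < ε → |v - t| < ε → dist (β u) (β v) = |u - v|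

/-- A polygon: a closed topological disk whose boundary is a polygonal simple closed curve. It is
recorded with an arc-length parametrization `β` of its boundary, extended periodically; `β` fixes
an orientation of the boundary. -/
structure PlanePolygon (M : Type*) [MetricSpace M] where
  /-- The polygon as a subset of the plane. -/
  carrier : Set M
  /-- The length of the boundary. -/
  perimeter : ℝ
  /-- The arc-length parametrization of the boundary. -/
  β : ℝ → M
  perimeter_pos : 0 < perimeter
  periodic : Function.Periodic β perimeter
  /-- The boundary is a simple closed curve. -/
  injOn : InjOn β (Ico 0 perimeter)
  /-- The boundary is a concatenation of finitely many segments. -/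
  polygonal : ∃ (k : ℕ) (t : ℕ → ℝ), t 0 = 0 ∧ t k = perimeter ∧
    ∀ i < k, t i < t (i + 1) ∧ IsGeodesicOn β (Icc (t i) (t (i + 1)))
  /-- The polygon is a closed disk, with boundary the curve `β`. -/
  disk : ∃ h : ℂ → M, ContinuousOn h (Metric.closedBall 0 1) ∧
    InjOn h (Metric.closedBall 0 1) ∧ h '' Metric.closedBall 0 1 = carrier ∧
    h '' Metric.sphere 0 1 = range β
  /-- In the spherical case, the polygon is properly contained in a (closed) hemisphere. -/
  hemisphere : ∀ r, IsRoundSphere M r → ∃ v, carrier ⊂ Metric.closedBall v (r * (Real.pi / 2))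

/-- The boundary curve of a polygon. -/
def PlanePolygon.boundary {M : Type*} [MetricSpace M] (P : PlanePolygon M) : Set M :=
  range P.β

/-! ### Paper-folding schemes -/

/-- A segment pairing `⟨α, α'⟩` on the boundary of `P`. The segments are
`α = β [s, s + len]` and `α' = β [s', s' + len]` (each segment contained in the boundary has this
form, and `t ↦ β (s + t)` is its arc-length parametrization compatible with the orientation).
Replacing the orientation of the boundary by the opposite one gives the same pairings. -/
structure SegmentPairing {M : Type*} [MetricSpace M] (P : PlanePolygon M) where
  s : ℝ
  s' : ℝ
  /-- The common length of the two segments. -/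
  len : ℝ
  len_pos : 0 < len
  geodesic : IsGeodesicOn P.β (Icc s (s + len))
  geodesic' : IsGeodesicOn P.β (Icc s' (s' + len))
  disjoint : Disjoint (P.β '' Ioo s (s + len)) (P.β '' Ioo s' (s' + len))

section Pairing

variable {M : Type*} [MetricSpace M] {P : PlanePolygon M}

/-- The segment `α`. -/
def SegmentPairing.seg (p : SegmentPairing P) : Set M := P.β '' Icc p.s (p.s + p.len)

/-- The segment `α'`. -/
def SegmentPairing.seg' (p : SegmentPairing P) : Set M := P.β '' Icc p.s' (p.s' + p.len)

/-- The union of the interiors of the segments `α` and `α'`. -/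
def SegmentPairing.interior (p : SegmentPairing P) : Set M :=
  P.β '' Ioo p.s (p.s + p.len) ∪ P.β '' Ioo p.s' (p.s' + p.len)

/-- The points `x` and `y` are paired, i.e. `{x, y} = {α (t), α' (len - t)}` for some `t`. -/
def SegmentPairing.Paired (p : SegmentPairing P) (x y : M) : Prop :=
  ∃ t ∈ Icc 0 p.len,
    (x = P.β (p.s + t) ∧ y = P.β (p.s' + (p.len - t))) ∨
    (y = P.β (p.s + t) ∧ x = P.β (p.s' + (p.len - t)))

end Pairing

/-- A paper-folding scheme on the polygon `P`: a full interior disjoint collection of segment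
pairings of the boundary of `P`. -/
structure FoldingScheme {M : Type*} [MetricSpace M] (P : PlanePolygon M) where
  pairings : Set (SegmentPairing P)
  interiorDisjoint : pairings.Pairwise fun p q => Disjoint p.interior q.interior
  full : HasSum (fun p : pairings => p.1.len) (P.perimeter / 2)

section Scheme

variable {M : Type*} [MetricSpace M] {P : PlanePolygon M}

/-- The reflexive and symmetric relation associated to a paper-folding scheme. -/
def FoldingScheme.Rel (Φ : FoldingScheme P) (x y : M) : Prop :=
  x = y ∨ ∃ p ∈ Φ.pairings, p.Paired x y

theorem FoldingScheme.Rel.symm (Φ : FoldingScheme P) (x y : M) (h : Φ.Rel x y) :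
    Φ.Rel y x := by
  rcases h with h | ⟨p, hp, t, ht, h⟩
  · exact Or.inl h.symm
  · exact Or.inr ⟨p, hp, t, ht, h.symm⟩

/-- The polygon `P`, to be equipped with the quotient semi-metric of a paper-folding scheme. -/
def FoldingScheme.Pre (_Φ : FoldingScheme P) : Type _ := P.carrier

/-- The quotient semi-metric on `P` associated to the scheme, `P` having its intrinsic metric. -/
instance (Φ : FoldingScheme P) : PseudoEMetricSpace Φ.Pre where
  edist := quotientEDist (X := P.carrier) (fun x y => intrinsicEDist P.carrier x.1 y.1)
    (fun x y => Φ.Rel x.1 y.1)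
  edist_self := quotientEDist_self _ _ fun x => intrinsicEDist_self _ _ x.2
  edist_comm := fun x y => by
    have hd : ∀ x y : P.carrier,
        intrinsicEDist P.carrier x.1 y.1 = intrinsicEDist P.carrier y.1 x.1 := fun x y =>
      le_antisymm (intrinsicEDist_le_symm _ _ _) (intrinsicEDist_le_symm _ _ _)
    exact le_antisymm
      (quotientEDist_le_symm _ _ hd (fun x y => FoldingScheme.Rel.symm Φ x.1 y.1) x y)
      (quotientEDist_le_symm _ _ hd (fun x y => FoldingScheme.Rel.symm Φ x.1 y.1) y x)
  edist_triangle := quotientEDist_triangle _ _ fun _ => Or.inl rfl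

/-- The paper space: the metric quotient of `P` obtained by identifying the points at
semi-distance zero. -/
abbrev FoldingScheme.PaperSpace (Φ : FoldingScheme P) : Type _ := SeparationQuotient Φ.Pre

end Scheme

/-! ### Plain schemes and plain arcs -/

/-- The pair `{x, x'}` lies in the closure of a connected component of `C ∖ {y, y'}`. -/
def OnOneSide {M : Type*} [MetricSpace M] (C : Set M) (x x' y y' : M) : Prop :=
  ∃ c ∈ C \ {y, y'}, {x, x'} ⊆ closure (connectedComponentIn (C \ {y, y'}) c)

/-- The pairs `{x, x'}` and `{y, y'}` of points of `C` are unlinked in `C`. -/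
def UnlinkedPairs {M : Type*} [MetricSpace M] (C : Set M) (x x' y y' : M) : Prop :=
  OnOneSide C x x' y y' ∨ OnOneSide C y y' x x'

/-- The restriction to `C` of the relation `R` is unlinked: any two unrelated pairs of related
points of `C` are unlinked. -/
def UnlinkedOn {M : Type*} [MetricSpace M] (C : Set M) (R : M → M → Prop) : Prop :=
  ∀ x ∈ C, ∀ x' ∈ C, ∀ y ∈ C, ∀ y' ∈ C, R x x' → R y y' →
    ¬ R x y → ¬ R x y' → ¬ R x' y → ¬ R x' y' → UnlinkedPairs C x x' y y'

/-- An arc contained in the boundary of `P`, given by an injective parametrization. -/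
structure BoundaryArc {M : Type*} [MetricSpace M] (P : PlanePolygon M) where
  toFun : ℝ → M
  continuousOn : ContinuousOn toFun (Icc 0 1)
  injOn : InjOn toFun (Icc 0 1)
  mapsTo : MapsTo toFun (Icc 0 1) P.boundary

section Plain

variable {M : Type*} [MetricSpace M] {P : PlanePolygon M}

/-- The arc as a set. -/
def BoundaryArc.carrier (γ : BoundaryArc P) : Set M := γ.toFun '' Icc 0 1

/-- The interior of the arc (the arc without its endpoints). -/
def BoundaryArc.interior (γ : BoundaryArc P) : Set M := γ.toFun '' Ioo 0 1

/-- The length of the arc. -/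
def BoundaryArc.length (γ : BoundaryArc P) : ℝ≥0∞ := eVariationOn γ.toFun (Icc 0 1)

/-- A paper-folding scheme on a single polygon is plain if its relation is unlinked. -/
def FoldingScheme.IsPlain (Φ : FoldingScheme P) : Prop := UnlinkedOn P.boundary Φ.Rel

/-- The arc `γ` is `Φ`-plain. -/
def BoundaryArc.IsPlain (γ : BoundaryArc P) (Φ : FoldingScheme P) : Prop :=
  (∀ p ∈ Φ.pairings, ((p.seg ∪ p.seg') ∩ γ.interior).Nonempty → p.seg ∪ p.seg' ⊆ γ.carrier) ∧
  UnlinkedOn γ.carrier Φ.Rel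

/-- The schemes `Φ` and `Ψ` agree off the interior of `γ`: they pair the same points of the part
of the boundary left over by `γ`. Whether the two endpoints of `γ` are paired with one another by
pairings contained in `γ` is not prescribed. -/
def FoldingScheme.AgreeOff (Φ Ψ : FoldingScheme P) (γ : BoundaryArc P) : Prop :=
  ∀ x ∈ P.boundary \ γ.carrier, ∀ y ∈ P.boundary \ γ.carrier, Φ.Rel x y ↔ Ψ.Rel x y

end Plain

end PaperFolding

end

/-! The identity of the polygon induces a correspondence between two paper spaces, so it suffices to
show that the two quotient semi-metrics differ by at most `γ.length`; this gives Gromov–Hausdorff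
distance at most `γ.length / 2`.

Measure a walk of the first scheme with the semi-metric of the second. A jump through a pairing that
misses the interior of `γ` costs nothing: its points are paired by the second scheme too, or are
limits of such pairs (`foldEDist_eq_zero_of_paired`). Any other jump has both ends in `γ`, by
plainness, and `γ` has intrinsic diameter at most its length. There may be many jumps of the latter
kind, but they are paid for only once: go straight from the first entry into `γ` to the last exit
(`Walk.le_length_add`). Exchanging the schemes gives the opposite inequality. -/

namespace PaperFolding

/-! ### Quotient semi-metrics -/

section Quotient

variable {X : Type*} {d : X → X → ℝ≥0∞} {R : X → X → Prop}

theorem quotientEDist_le (x y : X) : quotientEDist d R x y ≤ d x y := by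
  refine iInf_le_of_le
    ⟨0, fun _ => x, fun _ => y, rfl, rfl, fun i hi => absurd hi (Nat.not_lt_zero i)⟩ ?_
  simp [Walk.length]

theorem quotientEDist_eq_zero_of_rel (hd : ∀ x, d x x = 0) {x y : X} (h : R x y) :
    quotientEDist d R x y = 0 := by
  refine le_antisymm (iInf_le_of_le
    ⟨1, fun i => if i = 0 then x else y, fun i => if i = 0 then x else y, by simp, by simp,
      fun i hi => ?_⟩ ?_) bot_le
  · obtain rfl : i = 0 := by omega
    simpa using h
  · simp [Walk.length, hd]

/-- If every jump of a walk either has zero length for `D` or joins points of a set `G` of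
`D`-diameter at most `L`, then a single passage through `G` replaces all the jumps of the second
kind. -/
theorem Walk.le_length_add {x y : X} (w : Walk R x y) {D : X → X → ℝ≥0∞}
    (hDd : ∀ a b, D a b ≤ d a b) (htri : ∀ a b c, D a c ≤ D a b + D b c) {G : Set X} {L : ℝ≥0∞}
    (hG : ∀ a ∈ G, ∀ b ∈ G, D a b ≤ L)
    (hR : ∀ a b, R a b → D a b = 0 ∨ a ∈ G ∧ b ∈ G) :
    D x y ≤ w.length d + L := by
  -- Invariant along the walk: either no jump through `G` has been used, or `g` is where the first
  -- one starts and `g'` where the latest one ends.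
  have key : ∀ n ≤ w.N,
      D x (w.q n) ≤ ∑ i ∈ Finset.range (n + 1), d (w.p i) (w.q i) ∨
      ∃ g ∈ G, ∃ g' ∈ G,
        D x g + D g' (w.q n) ≤ ∑ i ∈ Finset.range (n + 1), d (w.p i) (w.q i) := by
    intro n
    induction n with
    | zero =>
      intro _
      left
      simpa [w.start] using hDd x (w.q 0)
    | succ n ih =>
      intro hn
      have hstep := hDd (w.p (n + 1)) (w.q (n + 1))
      rw [Finset.sum_range_succ]
      rcases hR _ _ (w.jump n (by omega)) with h0 | ⟨ha, hb⟩
      · have hq : ∀ z, D z (w.q (n + 1)) ≤ D z (w.q n) + d (w.p (n + 1)) (w.q (n + 1)) :=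
          fun z => calc
            D z (w.q (n + 1)) ≤ D z (w.q n) + D (w.q n) (w.q (n + 1)) := htri _ _ _
            _ ≤ D z (w.q n) + (D (w.q n) (w.p (n + 1)) + D (w.p (n + 1)) (w.q (n + 1))) := by
              gcongr; exact htri _ _ _
            _ ≤ D z (w.q n) + d (w.p (n + 1)) (w.q (n + 1)) := by
              rw [h0, zero_add]; gcongr
        rcases ih (by omega) with h | ⟨g, hg, g', hg', h⟩
        · exact Or.inl ((hq x).trans (by gcongr))
        · refine Or.inr ⟨g, hg, g', hg', ?_⟩
          calc _ ≤ D x g + (D g' (w.q n) + d (w.p (n + 1)) (w.q (n + 1))) := by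
                gcongr; exact hq g'
            _ ≤ _ := by rw [← add_assoc]; gcongr
      · right
        rcases ih (by omega) with h | ⟨g, hg, g', hg', h⟩
        · exact ⟨_, ha, _, hb, add_le_add h hstep⟩
        -- The first entry `g` is kept, the exit moves to `p (n + 1)`, and the stretch from the old
        -- exit to `q n` is dropped.
        · exact ⟨g, hg, _, hb, add_le_add (le_self_add.trans h) hstep⟩
  have hlen : w.length d = ∑ i ∈ Finset.range (w.N + 1), d (w.p i) (w.q i) := rfl
  rw [hlen]
  rcases key w.N le_rfl with h | ⟨g, hg, g', hg', h⟩
  · rw [w.finish] at h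
    exact h.trans le_self_add
  · rw [w.finish] at h
    calc D x y ≤ D x g + D g y := htri _ _ _
      _ ≤ D x g + (D g g' + D g' y) := by gcongr; exact htri _ _ _
      _ = D x g + D g' y + D g g' := by ring
      _ ≤ _ := add_le_add h (hG _ hg _ hg')

end Quotient

/-! ### Geodesics and intrinsic distances -/

section Geodesic

variable {M : Type*} [MetricSpace M] {β : ℝ → M} {I J : Set ℝ}

theorem IsGeodesicOn.comp (h : IsGeodesicOn β I) {σ : ℝ → ℝ}
    (hσ : ∀ u v, |σ u - σ v| = |u - v|) (hm : MapsTo σ J I) : IsGeodesicOn (β ∘ σ) J := by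
  intro t ht
  obtain ⟨ε, hε, H⟩ := h (σ t) (hm ht)
  refine ⟨ε, hε, fun u hu v hv hut hvt => ?_⟩
  rw [← hσ] at hut hvt ⊢
  exact H _ (hm hu) _ (hm hv) hut hvt

/-- Geodesics are locally injective, so a given value is not taken at parameters near `t` other than
`t`. This serves to avoid the endpoints of an arc. -/
theorem IsGeodesicOn.eventually_ne (h : IsGeodesicOn β I) {t : ℝ} (ht : t ∈ I) (e : M) :
    ∀ᶠ u in 𝓝[I \ {t}] t, β u ≠ e := by
  obtain ⟨ε, hε, H⟩ := h t ht
  -- If `β t = e`, local injectivity suffices and `δ` is arbitrary; otherwise `β u` stays too close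
  -- to `β t` to reach `e`.
  obtain ⟨δ, hδ, hδe⟩ : ∃ δ > 0, β t = e ∨ δ ≤ dist e (β t) := by
    rcases eq_or_ne (β t) e with he | he
    · exact ⟨1, one_pos, Or.inl he⟩
    · exact ⟨_, dist_pos.2 he.symm, Or.inr le_rfl⟩
  filter_upwards [self_mem_nhdsWithin,
    mem_nhdsWithin_of_mem_nhds (Metric.ball_mem_nhds t (lt_min hε hδ))] with u hu hu'
  rw [Metric.mem_ball, Real.dist_eq] at hu'
  have hd : dist (β u) (β t) = |u - t| :=
    H u hu.1 t ht (hu'.trans_le (min_le_left _ _)) (by simpa using hε)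
  rintro rfl
  rcases hδe with h0 | h0
  · rw [h0, dist_self] at hd
    exact hu.2 (sub_eq_zero.1 (abs_eq_zero.1 hd.symm))
  · exact absurd (hu'.trans_le (min_le_right _ _)) (by rw [← hd]; exact not_lt.2 h0)

/-- The geodesic from `t` to `u`, reparametrized affinely on `[0, 1]`, is a `|u - t|`-Lipschitz
curve in `A`. Only nearby `u` are considered because `β` is only locally isometric. -/
theorem IsGeodesicOn.eventually_intrinsicEDist_le {A : Set M} (h : IsGeodesicOn β I)
    (hI : Convex ℝ I) (hA : MapsTo β I A) {t : ℝ} (ht : t ∈ I) :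
    ∀ᶠ u in 𝓝[I] t, intrinsicEDist A (β t) (β u) ≤ ENNReal.ofReal |u - t| := by
  obtain ⟨ε, hε, H⟩ := h t ht
  filter_upwards [self_mem_nhdsWithin,
    mem_nhdsWithin_of_mem_nhds (Metric.ball_mem_nhds t hε)] with u hu hut
  rw [Metric.mem_ball, Real.dist_eq] at hut
  have hmem : ∀ τ ∈ Icc (0 : ℝ) 1, t + τ * (u - t) ∈ I := fun τ hτ => by
    have := hI ht hu (sub_nonneg.2 hτ.2) hτ.1 (by ring)
    simp only [smul_eq_mul] at this
    convert this using 1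
    ring
  have hnear : ∀ τ ∈ Icc (0 : ℝ) 1, |t + τ * (u - t) - t| < ε := fun τ hτ => by
    rw [add_sub_cancel_left, abs_mul, abs_of_nonneg hτ.1]
    exact (mul_le_of_le_one_left (abs_nonneg _) hτ.2).trans_lt hut
  have hlip : LipschitzOnWith (Real.toNNReal |u - t|) (fun τ => β (t + τ * (u - t)))
      (Icc (0 : ℝ) 1) := by
    refine LipschitzOnWith.of_dist_le_mul fun τ hτ τ' hτ' => le_of_eq ?_
    rw [H _ (hmem τ hτ) _ (hmem τ' hτ') (hnear τ hτ) (hnear τ' hτ'), Real.coe_toNNReal _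
      (abs_nonneg _), Real.dist_eq, ← abs_mul]
    congr 1
    ring
  refine iInf_le_of_le ⟨_, hlip.continuousOn, fun τ hτ => hA (hmem τ hτ), by simp, by simp⟩ ?_
  have hvar : eVariationOn (id : ℝ → ℝ) (Icc 0 1) = 1 := by
    simp
  calc _ ≤ (Real.toNNReal |u - t| : ℝ≥0∞) * eVariationOn (id : ℝ → ℝ) (Icc 0 1) :=
        hlip.comp_eVariationOn_le (g := id) (fun _ hτ => hτ)
    _ = ENNReal.ofReal |u - t| := by rw [hvar, mul_one]; rfl

end Geodesic

/-! ### Arcs in the boundary and their intrinsic diameter -/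

section Arc

variable {M : Type*} [MetricSpace M] {P : PlanePolygon M}

theorem PlanePolygon.boundary_subset_carrier (P : PlanePolygon M) : P.boundary ⊆ P.carrier := by
  obtain ⟨h, -, -, hc, hs⟩ := P.disk
  rw [PlanePolygon.boundary, ← hs, ← hc]
  exact image_mono Metric.sphere_subset_closedBall

theorem BoundaryArc.carrier_subset_boundary (γ : BoundaryArc P) : γ.carrier ⊆ P.boundary :=
  γ.mapsTo.image_subset

theorem BoundaryArc.mem_interior_or_eq (γ : BoundaryArc P) {x : M} (hx : x ∈ γ.carrier) :
    x ∈ γ.interior ∨ x = γ.toFun 0 ∨ x = γ.toFun 1 := by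
  obtain ⟨t, ht, rfl⟩ := hx
  rcases eq_or_lt_of_le ht.1 with h0 | h0
  · exact Or.inr (Or.inl (by rw [h0]))
  · rcases eq_or_lt_of_le ht.2 with h1 | h1
    · exact Or.inr (Or.inr (by rw [h1]))
    · exact Or.inl ⟨t, ⟨h0, h1⟩, rfl⟩

theorem BoundaryArc.intrinsicEDist_le_length (γ : BoundaryArc P) {x y : M} (hx : x ∈ γ.carrier)
    (hy : y ∈ γ.carrier) : intrinsicEDist P.carrier x y ≤ γ.length := by
  suffices H : ∀ a ∈ Icc (0 : ℝ) 1, ∀ b ∈ Icc (0 : ℝ) 1, a ≤ b →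
      intrinsicEDist P.carrier (γ.toFun a) (γ.toFun b) ≤ γ.length by
    obtain ⟨a, ha, rfl⟩ := hx
    obtain ⟨b, hb, rfl⟩ := hy
    rcases le_total a b with hab | hab
    · exact H a ha b hb hab
    · exact (intrinsicEDist_le_symm _ _ _).trans (H b hb a ha hab)
  intro a ha b hb hab
  -- The subarc from `a` to `b` is the competing curve; a monotone reparametrization does not
  -- increase variation.
  have hm : MapsTo (fun τ : ℝ => a + τ * (b - a)) (Icc 0 1) (Icc 0 1) := fun τ hτ =>
    ⟨add_nonneg ha.1 (mul_nonneg hτ.1 (sub_nonneg.2 hab)), by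
      have := mul_le_of_le_one_left (sub_nonneg.2 hab) hτ.2
      linarith [hb.2]⟩
  refine iInf_le_of_le ⟨γ.toFun ∘ fun τ => a + τ * (b - a),
    γ.continuousOn.comp (by fun_prop) hm,
    fun τ hτ => P.boundary_subset_carrier (γ.mapsTo (hm hτ)), by simp, by simp⟩ ?_
  refine eVariationOn.comp_le_of_monotoneOn _ _ (fun τ _ τ' _ h => ?_) hm
  exact add_le_add_right (mul_le_mul_of_nonneg_right h (sub_nonneg.2 hab)) _

end Arc

/-! ### Comparing two folding schemes -/

section Compare

variable {M : Type*} [MetricSpace M] {P : PlanePolygon M} {Φ Ψ : FoldingScheme P}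
  {γ : BoundaryArc P}

theorem FoldingScheme.AgreeOff.symm (h : Φ.AgreeOff Ψ γ) : Ψ.AgreeOff Φ γ :=
  fun x hx y hy => (h x hx y hy).symm

/-- The quotient semi-metric of a folding scheme, as a function on the polygon. -/
noncomputable def FoldingScheme.foldEDist (Φ : FoldingScheme P) (x y : P.carrier) : ℝ≥0∞ :=
  edist (α := Φ.Pre) x y

theorem FoldingScheme.foldEDist_comm (x y : P.carrier) : Φ.foldEDist x y = Φ.foldEDist y x :=
  edist_comm (α := Φ.Pre) x y

theorem FoldingScheme.foldEDist_triangle (x y z : P.carrier) :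
    Φ.foldEDist x z ≤ Φ.foldEDist x y + Φ.foldEDist y z :=
  edist_triangle (α := Φ.Pre) x y z

theorem FoldingScheme.foldEDist_le_intrinsicEDist (x y : P.carrier) :
    Φ.foldEDist x y ≤ intrinsicEDist P.carrier x.1 y.1 :=
  quotientEDist_le x y

theorem FoldingScheme.foldEDist_eq_zero {x y : P.carrier} (h : Φ.Rel x.1 y.1) :
    Φ.foldEDist x y = 0 :=
  quotientEDist_eq_zero_of_rel (X := P.carrier)
    (d := fun x y => intrinsicEDist P.carrier x.1 y.1) (R := fun x y => Φ.Rel x.1 y.1)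
    (fun x => intrinsicEDist_self _ _ x.2) h

/-- The points paired by a pairing not contained in `γ` are limits of pairs of points off `γ`, so
they are still identified by any scheme that agrees with the given one off `γ`. -/
theorem FoldingScheme.foldEDist_eq_zero_of_paired (hagree : Φ.AgreeOff Ψ γ)
    {p : SegmentPairing P} (hp : p ∈ Φ.pairings)
    (hdisj : ¬ ((p.seg ∪ p.seg') ∩ γ.interior).Nonempty)
    {x y : P.carrier} (h : p.Paired x.1 y.1) : Ψ.foldEDist x y = 0 := by
  wlog hxy : ∃ t ∈ Icc 0 p.len, x.1 = P.β (p.s + t) ∧ y.1 = P.β (p.s' + (p.len - t))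
    generalizing x y
  · obtain ⟨t, ht, h' | h'⟩ := h
    · exact absurd ⟨t, ht, h'⟩ hxy
    · rw [foldEDist_comm]
      exact this ⟨t, ht, Or.inl h'⟩ ⟨t, ht, h'⟩
  obtain ⟨t, ht, hx, hy⟩ := hxy
  have hmem : ∀ u, P.β u ∈ P.boundary := fun u => mem_range_self u
  have hmem' : ∀ u, P.β u ∈ P.carrier := fun u => P.boundary_subset_carrier (hmem u)
  set I : Set ℝ := Icc 0 p.len
  have hm : MapsTo (fun u => p.s + u) I (Icc p.s (p.s + p.len)) := fun u hu =>
    ⟨by linarith [hu.1], by linarith [hu.2]⟩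
  have hm' : MapsTo (fun u => p.s' + (p.len - u)) I (Icc p.s' (p.s' + p.len)) := fun u hu =>
    ⟨by linarith [hu.2], by linarith [hu.1]⟩
  have hg : IsGeodesicOn (P.β ∘ fun u => p.s + u) I :=
    p.geodesic.comp (fun u v => by congr 1; ring) hm
  have hg' : IsGeodesicOn (P.β ∘ fun u => p.s' + (p.len - u)) I :=
    p.geodesic'.comp (fun u v => by rw [abs_sub_comm u v]; congr 1; ring) hm'
  have hle : 𝓝[I \ {t}] t ≤ 𝓝[I] t := nhdsWithin_mono _ sdiff_subset
  -- The limit must be taken along a nontrivial filter: `t` is approached from the right if `t = 0`,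
  -- from the left otherwise.
  have hne : (𝓝[I \ {t}] t).NeBot := by
    rw [← mem_closure_iff_nhdsWithin_neBot]
    rcases eq_or_lt_of_le ht.1 with h0 | h0
    · have : Ioc t p.len ⊆ I \ {t} := fun u hu => ⟨⟨ht.1.trans hu.1.le, hu.2⟩, hu.1.ne'⟩
      refine closure_mono this ?_
      have hlt : t < p.len := h0 ▸ p.len_pos
      rw [closure_Ioc hlt.ne]
      exact left_mem_Icc.2 hlt.le
    · have : Ico 0 t ⊆ I \ {t} := fun u hu => ⟨⟨hu.1, hu.2.le.trans ht.2⟩, hu.2.ne⟩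
      refine closure_mono this ?_
      rw [closure_Ico h0.ne]
      exact right_mem_Icc.2 h0.le
  -- Replacing `t` by a nearby `u ≠ t` moves each of the two points by at most `|u - t|`. The new
  -- points avoid the interior of `γ` by `hdisj` and its endpoints by `eventually_ne`, so they lie
  -- off `γ` and `Ψ` identifies them.
  have hbound : ∀ᶠ u in 𝓝[I \ {t}] t,
      Ψ.foldEDist x y ≤ ENNReal.ofReal |u - t| + ENNReal.ofReal |u - t| := by
    filter_upwards [self_mem_nhdsWithin,
      hg.eventually_ne ht (γ.toFun 0), hg.eventually_ne ht (γ.toFun 1),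
      hg'.eventually_ne ht (γ.toFun 0), hg'.eventually_ne ht (γ.toFun 1),
      hle (hg.eventually_intrinsicEDist_le (convex_Icc _ _) (fun u _ => hmem' _) ht),
      hle (hg'.eventually_intrinsicEDist_le (convex_Icc _ _) (fun u _ => hmem' _) ht)]
      with u hu h0 h1 h0' h1' hd hd'
    simp only [Function.comp_apply] at h0 h1 h0' h1' hd hd'
    have hoff : P.β (p.s + u) ∉ γ.carrier := fun hc =>
      (γ.mem_interior_or_eq hc).elim
        (fun hi => hdisj ⟨_, Or.inl ⟨_, hm hu.1, rfl⟩, hi⟩) (fun he => he.elim h0 h1)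
    have hoff' : P.β (p.s' + (p.len - u)) ∉ γ.carrier := fun hc =>
      (γ.mem_interior_or_eq hc).elim
        (fun hi => hdisj ⟨_, Or.inr ⟨_, hm' hu.1, rfl⟩, hi⟩) (fun he => he.elim h0' h1')
    have hrel : Ψ.Rel (P.β (p.s + u)) (P.β (p.s' + (p.len - u))) :=
      (hagree _ ⟨hmem _, hoff⟩ _ ⟨hmem _, hoff'⟩).1
        (Or.inr ⟨p, hp, u, hu.1, Or.inl ⟨rfl, rfl⟩⟩)
    let a : P.carrier := ⟨P.β (p.s + u), hmem' _⟩
    let b : P.carrier := ⟨P.β (p.s' + (p.len - u)), hmem' _⟩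
    have hxa : Ψ.foldEDist x a ≤ ENNReal.ofReal |u - t| :=
      (foldEDist_le_intrinsicEDist x a).trans (by rw [hx]; exact hd)
    have hby : Ψ.foldEDist b y ≤ ENNReal.ofReal |u - t| := by
      rw [foldEDist_comm]
      exact (foldEDist_le_intrinsicEDist y b).trans (by rw [hy]; exact hd')
    have hab : Ψ.foldEDist a b = 0 := foldEDist_eq_zero hrel
    calc Ψ.foldEDist x y
        ≤ Ψ.foldEDist x a + Ψ.foldEDist a b + Ψ.foldEDist b y :=
          (foldEDist_triangle _ b _).trans (by gcongr; exact foldEDist_triangle _ _ _)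
      _ ≤ _ := by rw [hab, add_zero]; exact add_le_add hxa hby
  have hlim : Tendsto (fun u => ENNReal.ofReal |u - t| + ENNReal.ofReal |u - t|)
      (𝓝[I \ {t}] t) (𝓝 0) := by
    have hc : Continuous fun u : ℝ => ENNReal.ofReal |u - t| + ENNReal.ofReal |u - t| := by
      have := ENNReal.continuous_ofReal.comp (continuous_abs.comp (continuous_sub_right t))
      exact this.add this
    simpa using (hc.tendsto t).mono_left nhdsWithin_le_nhds
  exact le_antisymm (ge_of_tendsto hlim hbound) bot_le

theorem FoldingScheme.foldEDist_le_add_length (hγ : γ.IsPlain Φ) (hagree : Φ.AgreeOff Ψ γ)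
    (x y : P.carrier) :
    Ψ.foldEDist x y ≤ Φ.foldEDist x y + γ.length := by
  -- Only the `Φ` side is unfolded into walks; the `Ψ` semi-metric plays the role of `D`.
  change _ ≤ (⨅ w : Walk _ x y, w.length _) + _
  rw [ENNReal.iInf_add]
  refine le_iInf fun w => ?_
  refine w.le_length_add (D := Ψ.foldEDist)
    foldEDist_le_intrinsicEDist
    foldEDist_triangle (G := {a | a.1 ∈ γ.carrier})
    (fun a ha b hb =>
      (foldEDist_le_intrinsicEDist a b).trans (γ.intrinsicEDist_le_length ha hb)) ?_
  rintro a b (hab | ⟨p, hp, hab⟩)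
  · exact Or.inl (foldEDist_eq_zero (Or.inl hab))
  -- Plainness puts a pairing that meets the interior of `γ` entirely inside `γ`; any other pairing
  -- is free for `Ψ`.
  · by_cases hd : ((p.seg ∪ p.seg') ∩ γ.interior).Nonempty
    · refine Or.inr ?_
      have hsub := hγ.1 p hp hd
      have hs : ∀ t ∈ Icc 0 p.len, P.β (p.s + t) ∈ γ.carrier := fun t ht =>
        hsub (Or.inl ⟨_, ⟨by linarith [ht.1], by linarith [ht.2]⟩, rfl⟩)
      have hs' : ∀ t ∈ Icc 0 p.len, P.β (p.s' + (p.len - t)) ∈ γ.carrier := fun t ht =>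
        hsub (Or.inr ⟨_, ⟨by linarith [ht.2], by linarith [ht.1]⟩, rfl⟩)
      obtain ⟨t, ht, ⟨h1, h2⟩ | ⟨h1, h2⟩⟩ := hab
      · exact ⟨by rw [mem_ofPred_eq, h1]; exact hs t ht, by rw [mem_ofPred_eq, h2]; exact hs' t ht⟩
      · exact ⟨by rw [mem_ofPred_eq, h2]; exact hs' t ht, by rw [mem_ofPred_eq, h1]; exact hs t ht⟩
    · exact Or.inl (foldEDist_eq_zero_of_paired hagree hp hd hab)

/-- The correspondence between two paper spaces induced by the identity of the polygon has
distortion at most the length of an arc off which the schemes agree. -/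
theorem FoldingScheme.gromovHausdorffEDist_le (hΦ : γ.IsPlain Φ) (hΨ : γ.IsPlain Ψ)
    (hagree : Φ.AgreeOff Ψ γ) :
    gromovHausdorffEDist Φ.PaperSpace Ψ.PaperSpace ≤ γ.length / 2 := by
  let R : Set (Φ.PaperSpace × Ψ.PaperSpace) :=
    range fun x : P.carrier =>
      (SeparationQuotient.mk (X := Φ.Pre) x, SeparationQuotient.mk (X := Ψ.Pre) x)
  have hR : IsCorrespondence R := by
    constructor
    · intro x
      obtain ⟨a, rfl⟩ := SeparationQuotient.surjective_mk x
      exact ⟨_, a, rfl⟩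
    · intro y
      obtain ⟨a, rfl⟩ := SeparationQuotient.surjective_mk y
      exact ⟨_, a, rfl⟩
  refine ENNReal.div_le_div_right (iInf_le_of_le ⟨R, hR⟩ ?_) 2
  refine iSup₂_le ?_
  rintro _ ⟨a, rfl⟩
  refine iSup₂_le ?_
  rintro _ ⟨b, rfl⟩
  -- Each truncated difference is bounded by one direction of the comparison, which is why `γ` must
  -- be plain for both schemes.
  exact max_le (tsub_le_iff_left.2 (foldEDist_le_add_length hΨ hagree.symm a b))
    (tsub_le_iff_left.2 (foldEDist_le_add_length hΦ hagree a b))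

end Compare

end PaperFolding

/-! ### Convergence as the arcs shrink -/

theorem theorem2 {M : Type*} [MetricSpace M] (hM : PaperFolding.IsModelPlane M)
    (P : PaperFolding.PlanePolygon M)
    (Φ : PaperFolding.FoldingScheme P) (hΦ : Φ.IsPlain)
    (γ : ℕ → PaperFolding.BoundaryArc P) (hγ : ∀ n, (γ n).IsPlain Φ)
    (Ψ : ℕ → PaperFolding.FoldingScheme P)
    (hagree : ∀ n, (Ψ n).AgreeOff Φ (γ n))
    (hγ' : ∀ n, (γ n).IsPlain (Ψ n))
    (hlen : Tendsto (fun n => (γ n).length) atTop (𝓝 0)) :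
    Tendsto (fun n => PaperFolding.gromovHausdorffEDist Φ.PaperSpace (Ψ n).PaperSpace)
      atTop (𝓝 0) := by
  have hhalf : Tendsto (fun n => (γ n).length / 2) atTop (𝓝 0) := by
    simpa using ENNReal.Tendsto.div_const hlen (Or.inr two_ne_zero)
  exact tendsto_of_tendsto_of_tendsto_of_le_of_le tendsto_const_nhds hhalf (fun _ => bot_le)
    fun n => PaperFolding.FoldingScheme.gromovHausdorffEDist_le (hγ n) (hγ' n) (hagree n).symm
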